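/- **Fault-tolerance condition for the $s$-measurement.** Let $\mathcal H=L^2(\mathbb R)$ be the Hilbert space of one oscillator mode with quadratures $[\hat q,\hat p]=i$, put $c=\sqrt\pi$, and let $\hat V(v_1,v_2)=\exp[-i(v_1\hat p-v_2\hat q)]$. For $\mu\in\{0,1\}$ and $z_1,z_2\in[-\frac c2,\frac c2)$ let $$|\mu;z_1,z_2\rangle=\frac{e^{iz_1z_2/2}}{\sqrt c}\sum_{k\in\mathbb Z}e^{icz_2(2k+\mu)}\,|z_1+c(2k+\mu)\rangle_q ,$$ where $|x\rangle_q$ is the (generalized) eigenvector of $\hat q$ with eigenvalue $x$; these vectors identify $\mathcal H$ with $\mathbb C^2\otimes\mathcal H_S$, $\mathcal H_S=L^2([-\frac c2,\frac c2)^2)$ (logical qubit and syndrome subsystem), through $|\mu;z_1,z_2\rangle=|\mu\rangle\otimes|z_1,z_2\rangle$. For $0<r\le \frac c2$ let $$\hat\Pi_r=\sum_{\mu=0,1}\int_{|z_1|<r}\int_{|z_2|<r}|\mu;z_1,z_2\rangle\langle\mu;z_1,z_2|\,dz_1dz_2$$ be the $r$-filter, and let $\mathcal D_{\rm GKP}(T)=\mathrm{Tr}_S(T)$,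 for trace-class $T$ on $\mathcal H$, be the ideal GKP decoder, a map to operators on the qubit $\mathbb C^2$. An $s$-parameterized noise channel $\mathcal N^s$ is a completely positive trace-preserving map on the trace-class operators of $\mathcal H$ whose Kraus operators are linear combinations (finite, or continuous, i.e. limits of finite ones in the weak operator topology) of displacements $\hat V(z_1,z_2)$ with $(z_1,z_2)\in[-s,s)^2$, or which has the form $$\mathcal N^s(T)=\int_{\mathbb R^4}\mathcal E_s(z,z')\,\hat V(z)\,T\,\hat V(z')^\dagger\,d^2z\,d^2z'$$ with an integrable function (or, more generally, a finite complex measure) $\mathcal E_s$ supported on $[-s,s)^4$. The $s$-measurement of $\overline Z$ (respectively $\overline X$) applies $\mathcal N^s$, then performs ideal homodyne detection of $\hat q$ (respectively $\hat p$) with outcome $t\in\mathbb R$, and outputs the bit $\lfloor t/c+\frac12\rfloor \bmod 2$. **Claim.** If $r>0$ and $r+s<\frac{\sqrt\pi}2$, then for every $s$-parameterized noise channel $\mathcal N^s$, every density operator $\hat\rho$ on $\mathcal H$, both bases $\overline Z$ and $\overline X$, and each outcome $\mu\in\{0,1\}$, the (unnormalized) probability that the $s$-measurement applied to $\hat\Pi_r\hat\rho\hat\Pi_r$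 outputs $\mu$ equals $$\mathrm{Tr}\bigl[P_\mu\,\mathcal D_{\rm GKP}(\hat\Pi_r\hat\rho\hat\Pi_r)\bigr],$$ where $P_\mu=\frac12\bigl(I+(-1)^\mu\sigma\bigr)$ with $\sigma$ the qubit Pauli operator $Z$ (respectively $X$). That is, the $s$-measurement of an $r$-filtered input has the same outcome distribution as the ideal GKP decoder followed by the ideal qubit Pauli measurement. -/

import Mathlib

open MeasureTheory Set
open scoped ENNReal InnerProductSpace ComplexOrder

namespace GKP

noncomputable section

/-! ### Trace-class operators and quantum channels on a complex Hilbert space -/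

section Hilbert

variable (E : Type) [NormedAddCommGroup E] [InnerProductSpace ℂ E] [CompleteSpace E]

/-- The trace-class operators, i.e. the operators `T = ∑ₙ |xₙ⟩⟨yₙ|` with `∑ₙ ‖xₙ‖ ‖yₙ‖ < ∞`. -/
def traceClass : Submodule ℂ (E →L[ℂ] E) where
  carrier := {T | ∃ x y : ℕ → E, Summable (fun n => ‖x n‖ * ‖y n‖) ∧
    ∀ v, HasSum (fun n => ⟪y n, v⟫_ℂ • x n) (T v)}
  zero_mem' := ⟨0, 0, by simp, fun v => by simp⟩
  add_mem' := by
    rintro S T ⟨x, y, hs, hS⟩ ⟨x', y', hs', hT⟩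
    let e : ℕ ≃ ℕ ⊕ ℕ := Equiv.natSumNatEquivNat.symm
    refine ⟨fun n => Sum.elim x x' (e n), fun n => Sum.elim y y' (e n), ?_, fun v => ?_⟩
    · let F : ℕ ⊕ ℕ → ℝ := fun k => ‖Sum.elim x x' k‖ * ‖Sum.elim y y' k‖
      have h1 : HasSum (F ∘ Sum.inl) (∑' n, ‖x n‖ * ‖y n‖) := hs.hasSum
      have h2 : HasSum (F ∘ Sum.inr) (∑' n, ‖x' n‖ * ‖y' n‖) := hs'.hasSum
      exact ((e.hasSum_iff (f := F)).2 (h1.sum h2)).summable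
    · let G : ℕ ⊕ ℕ → E := fun k => ⟪Sum.elim y y' k, v⟫_ℂ • Sum.elim x x' k
      have h1 : HasSum (G ∘ Sum.inl) (S v) := hS v
      have h2 : HasSum (G ∘ Sum.inr) (T v) := hT v
      exact (e.hasSum_iff (f := G)).2 (h1.sum h2)
  smul_mem' := by
    rintro a T ⟨x, y, hs, hT⟩
    refine ⟨fun n => a • x n, y, ?_, fun v => ?_⟩
    · simpa [norm_smul, mul_assoc] using hs.mul_left ‖a‖
    · simpa [smul_comm a] using (hT v).const_smul a

variable {E}

theorem conj_mem_traceClass (A B : E →L[ℂ] E) {T : E →L[ℂ] E} (hT : T ∈ traceClass E) :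
    A ∘L T ∘L B ∈ traceClass E := by
  obtain ⟨x, y, hs, h⟩ := hT
  refine ⟨fun n => A (x n), fun n => ContinuousLinearMap.adjoint B (y n), ?_, fun v => ?_⟩
  · refine Summable.of_nonneg_of_le (fun n => by positivity) (fun n => ?_)
      (hs.mul_left (‖A‖ * ‖ContinuousLinearMap.adjoint B‖))
    calc ‖A (x n)‖ * ‖ContinuousLinearMap.adjoint B (y n)‖
        ≤ (‖A‖ * ‖x n‖) * (‖ContinuousLinearMap.adjoint B‖ * ‖y n‖) := by
          gcongr <;> exact ContinuousLinearMap.le_opNorm _ _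
      _ = _ := by ring
  · have := (h (B v)).mapL A
    simpa [ContinuousLinearMap.adjoint_inner_left] using this

/-- The operator `A T A†` for a trace-class operator `T`. -/
def conjBy (A : E →L[ℂ] E) (T : traceClass E) : traceClass E :=
  ⟨A ∘L T.1 ∘L ContinuousLinearMap.adjoint A, conj_mem_traceClass _ _ T.2⟩

/-- The trace `∑ᵢ ⟨eᵢ, T eᵢ⟩` over an orthonormal basis (for trace-class `T` the sum converges
absolutely and does not depend on the basis). -/
def trace (T : E →L[ℂ] E) : ℂ :=
  ∑' i, ⟪(exists_hilbertBasis ℂ E).choose_spec.choose i,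
    T ((exists_hilbertBasis ℂ E).choose_spec.choose i)⟫_ℂ

/-- Density operators. -/
def IsDensity (ρ : traceClass E) : Prop :=
  (∀ x, 0 ≤ ⟪x, ρ.1 x⟫_ℂ) ∧ trace ρ.1 = 1

/-- Completely positive trace-preserving maps (quantum channels) on the trace-class operators. -/
structure IsChannel (N : traceClass E →ₗ[ℂ] traceClass E) : Prop where
  completely_positive : ∀ (n : ℕ) (A : Fin n → Fin n → traceClass E),
    (∀ x : Fin n → E, 0 ≤ ∑ i, ∑ j, ⟪x i, (A i j).1 (x j)⟫_ℂ) →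
    ∀ x : Fin n → E, 0 ≤ ∑ i, ∑ j, ⟪x i, (N (A i j)).1 (x j)⟫_ℂ
  trace_preserving : ∀ T, trace (N T).1 = trace T.1

end Hilbert

/-- Multiplication by a measurable function bounded by `1`. -/
def mulOp {α : Type} [MeasurableSpace α] (m : Measure α) (g : α → ℂ) (hg : Measurable g)
    (hb : ∀ x, ‖g x‖ ≤ 1) : Lp ℂ 2 m →L[ℂ] Lp ℂ 2 m :=
  have key : ∀ f : Lp ℂ 2 m, MemLp (fun x => g x * f x) 2 m := fun f =>
    (Lp.memLp f).of_le_mul (c := 1) (hg.aestronglyMeasurable.mul (Lp.aestronglyMeasurable f))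
      (.of_forall fun x => by rw [norm_mul]; gcongr; exact hb x)
  LinearMap.mkContinuous
    { toFun := fun f => (key f).toLp
      map_add' := fun f₁ f₂ => by
        ext1
        filter_upwards [(key (f₁ + f₂)).coeFn_toLp, (key f₁).coeFn_toLp, (key f₂).coeFn_toLp,
          Lp.coeFn_add f₁ f₂, Lp.coeFn_add (key f₁).toLp (key f₂).toLp] with x h h₁ h₂ h₃ h₄
        rw [h, h₄, Pi.add_apply, h₁, h₂, h₃, Pi.add_apply, mul_add]
      map_smul' := fun a f => by
        ext1
        filter_upwards [(key (a • f)).coeFn_toLp, (key f).coeFn_toLp,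
          Lp.coeFn_smul a f, Lp.coeFn_smul a (key f).toLp] with x h h₁ h₂ h₃
        simp only [RingHom.id_apply]
        rw [h, h₃, Pi.smul_apply, h₁, h₂, Pi.smul_apply, smul_eq_mul, smul_eq_mul]
        ring }
    1 fun f => Lp.norm_le_mul_norm_of_ae_le_mul <| by
      filter_upwards [(key f).coeFn_toLp] with x h
      simp only [LinearMap.coe_mk, AddHom.coe_mk]
      rw [h, norm_mul]
      gcongr
      exact hb x

/-- The spectral projection "multiply by the indicator of `B`". -/
def indOp {α : Type} [MeasurableSpace α] (m : Measure α) (B : Set α) (hB : MeasurableSet B) :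
    Lp ℂ 2 m →L[ℂ] Lp ℂ 2 m :=
  mulOp m (B.indicator 1) (measurable_one.indicator hB) fun x => by
    by_cases h : x ∈ B <;> simp [h]

/-! ### The oscillator -/

/-- The Hilbert space of a single mode, in the position representation. -/
abbrev Mode : Type := Lp ℂ 2 (volume : Measure ℝ)

/-- The displacement `V(v₁, v₂) = exp(-i (v₁ p - v₂ q))`, i.e.
`(V(v₁, v₂) ψ)(x) = exp(i (v₂ x - v₁ v₂ / 2)) ψ(x - v₁)`. -/
def displacement (v₁ v₂ : ℝ) : Mode →L[ℂ] Mode :=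
  mulOp volume (fun x : ℝ => Complex.exp (Complex.I * ((v₂ * x - v₁ * v₂ / 2 : ℝ) : ℂ)))
      (by fun_prop) (fun x => by rw [mul_comm, Complex.norm_exp_ofReal_mul_I]) ∘L
    (Lp.compMeasurePreservingₗᵢ ℂ (fun x : ℝ => x - v₁)
      (measurePreserving_sub_right volume v₁)).toContinuousLinearMap

/-- The constant `c = √π`. -/
def c : ℝ := √Real.pi

/-! ### The stabilizer subsystem decomposition -/

/-- Lebesgue measure on the interval `[-c/2, c/2)`. -/
def cell : Measure ℝ := volume.restrict (Ico (-(c / 2)) (c / 2))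

/-- The syndrome subsystem: square-integrable functions on `[-c/2, c/2) × [-c/2, c/2)`. -/
abbrev Syndrome : Type := Lp ℂ 2 (cell.prod cell)

/-- The integer `n` for which `c n` is the multiple of `c` nearest to `x`. -/
def nearest (x : ℝ) : ℤ := ⌊x / c + 1 / 2⌋

/-- The wave function of `∬ f(z₁, z₂) |μ; z₁, z₂⟩ dz₁ dz₂`, where
`|μ; z₁, z₂⟩ = V(z₁, z₂) |μ̄⟩ = c^{-1/2} e^{i z₁ z₂ / 2} ∑ₛ e^{i c z₂ (2 s + μ)} |z₁ + c (2 s + μ)⟩_q`.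
The delta function at `x` selects `z₁ = x - c n` with `n = nearest x`, provided `n` has the
parity of `μ`. -/
def synthFun (μ : Fin 2) (f : ℝ × ℝ → ℂ) (x : ℝ) : ℂ :=
  if nearest x % 2 = ((μ : ℕ) : ℤ) then
    ((√c)⁻¹ : ℝ) * ∫ z₂, Complex.exp (Complex.I *
        (((x - c * nearest x) * z₂ / 2 + c * z₂ * nearest x : ℝ) : ℂ)) *
      f (x - c * nearest x, z₂) ∂cell
  else 0

theorem c_pos : 0 < c := Real.sqrt_pos.2 Real.pi_pos

theorem c_sq : c * c = Real.pi := Real.mul_self_sqrt Real.pi_pos.le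

instance : IsFiniteMeasure cell := by unfold cell; infer_instance

theorem nearest_add {z : ℝ} (hz : z ∈ Ico (-(c / 2)) (c / 2)) (n : ℤ) :
    nearest (z + c * n) = n := by
  have hc := c_pos
  unfold nearest
  rw [Int.floor_eq_iff]
  have : (z + c * n) / c = z / c + n := by field_simp
  rw [this]
  have h1 : -(1 / 2) ≤ z / c := by rw [le_div_iff₀ hc]; linarith [hz.1]
  have h2 : z / c < 1 / 2 := by rw [div_lt_iff₀ hc]; linarith [hz.2]
  constructor <;> linarith

theorem measurable_nearest : Measurable nearest := by unfold nearest; fun_prop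

theorem lintegral_tile (F : ℝ → ℝ≥0∞) :
    ∫⁻ x, F x = ∑' n : ℤ, ∫⁻ z, F (z + c * n) ∂cell := by
  have hu := iUnion_Ico_add_zsmul c_pos (-(c / 2))
  rw [← setLIntegral_univ, ← hu, lintegral_iUnion (fun _ => measurableSet_Ico)
    (pairwise_disjoint_Ico_add_zsmul _ _)]
  refine tsum_congr fun n => ?_
  unfold cell
  have hmp := measurePreserving_add_right (volume : Measure ℝ) (c * n)
  have hemb := (MeasurableEquiv.addRight (c * (n : ℝ))).measurableEmbedding
  have himg : Ico (-(c / 2) + n • c) (-(c / 2) + (n + 1) • c)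
      = (fun x => x + c * (n : ℝ)) '' Ico (-(c / 2)) (c / 2) := by
    rw [Set.image_add_const_Ico]
    simp only [zsmul_eq_mul]
    congr 1 <;> push_cast <;> ring
  rw [himg]
  exact (hmp.setLIntegral_comp_emb hemb F (Ico (-(c / 2)) (c / 2))).symm

theorem ae_of_cell {P : ℝ → Prop} (h : ∀ᵐ z ∂cell, P z) :
    ∀ᵐ x : ℝ, P (x - c * nearest x) := by
  obtain ⟨N, hN, hNm, hN0⟩ := exists_measurable_superset_of_null (ae_iff.1 h)
  have hm : Measurable fun x : ℝ => x - c * nearest x := by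
    have := measurable_nearest
    fun_prop
  refine measure_mono_null (t := (fun x : ℝ => x - c * nearest x) ⁻¹' N)
    (fun x hx => hN hx) ?_
  rw [← lintegral_indicator_one (hm hNm), lintegral_tile, ENNReal.tsum_eq_zero]
  intro n
  rw [← nonpos_iff_eq_zero, ← hN0, ← lintegral_indicator_one hNm]
  refine setLIntegral_mono' measurableSet_Ico fun z hz => ?_
  have hiff : z + c * n ∈ (fun x : ℝ => x - c * nearest x) ⁻¹' N ↔ z ∈ N := by
    rw [mem_preimage, nearest_add hz, add_sub_cancel_right]
  by_cases hzN : z ∈ N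
  · rw [indicator_of_mem (hiff.2 hzN), indicator_of_mem hzN, Pi.one_apply, Pi.one_apply]
  · rw [indicator_of_notMem (fun h => hzN (hiff.1 h)), indicator_of_notMem hzN]

theorem stronglyMeasurable_synthFun (μ : Fin 2) {f : ℝ × ℝ → ℂ} (hf : StronglyMeasurable f) :
    StronglyMeasurable (synthFun μ f) := by
  have hn := measurable_nearest
  refine StronglyMeasurable.ite ?_ ?_ stronglyMeasurable_const
  · exact measurableSet_eq_fun (f := fun x => nearest x % 2)
      ((measurable_from_top (f := fun k : ℤ => k % 2)).comp hn) measurable_const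
  · refine stronglyMeasurable_const.mul (StronglyMeasurable.integral_prod_right ?_)
    refine StronglyMeasurable.mul ?_ ?_
    · refine Measurable.stronglyMeasurable ?_
      have : Measurable fun p : ℝ × ℝ => nearest p.1 := hn.comp measurable_fst
      fun_prop
    · exact hf.comp_measurable (by fun_prop)

theorem synthFun_congr (μ : Fin 2) {f g : ℝ × ℝ → ℂ} (h : f =ᵐ[cell.prod cell] g) :
    synthFun μ f =ᵐ[volume] synthFun μ g := by
  filter_upwards [ae_of_cell (Measure.ae_ae_of_ae_prod h)] with x hx
  unfold synthFun
  congr 2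
  exact integral_congr_ae (by filter_upwards [hx] with z hz; rw [hz])

theorem slice_memLp {f : ℝ × ℝ → ℂ} (hf : StronglyMeasurable f)
    (h2 : ∫⁻ z, ‖f z‖ₑ ^ 2 ∂cell.prod cell < ∞) :
    ∀ᵐ z ∂cell, MemLp (fun w => f (z, w)) 2 cell := by
  have hfm := hf.measurable
  rw [lintegral_prod _ (by fun_prop)] at h2
  filter_upwards [ae_lt_top (Measurable.lintegral_prod_right' (ν := cell)
    (f := fun z => ‖f z‖ₑ ^ 2) (by fun_prop)) h2.ne] with z hz
  refine ⟨(hf.comp_measurable (by fun_prop)).aestronglyMeasurable, ?_⟩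
  rw [eLpNorm_lt_top_iff_lintegral_rpow_enorm_lt_top (by simp) (by simp)]
  simpa using hz

theorem integrable_slice {h : ℝ → ℂ} (hh : MemLp h 2 cell) (a : ℝ → ℝ) (ha : Measurable a) :
    Integrable (fun w => Complex.exp (Complex.I * ((a w : ℝ) : ℂ)) * h w) cell := by
  refine (hh.integrable (by norm_num)).bdd_mul (c := 1) (by fun_prop) (.of_forall fun w => ?_)
  rw [mul_comm, Complex.norm_exp_ofReal_mul_I]

/-- Parseval's identity on one cell. -/
theorem parseval_cell (μ : Fin 2) {h : ℝ → ℂ} (hh : MemLp h 2 cell) (a : ℝ) :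
    ∑' n : ℤ, (if n % 2 = ((μ : ℕ) : ℤ) then
      ‖(((√c)⁻¹ : ℝ) : ℂ) * ∫ w, Complex.exp (Complex.I * ((a * w + c * w * n : ℝ) : ℂ)) * h w
        ∂cell‖ₑ ^ 2 else 0) = ∫⁻ w, ‖h w‖ₑ ^ 2 ∂cell := by
  have hc := c_pos
  have hcell : cell = volume.restrict (Ioc (-(c / 2)) (c / 2)) :=
    Measure.restrict_congr_set Ico_ae_eq_Ioc
  let k : ℝ → ℂ := fun w =>
    Complex.exp (Complex.I * ((a * w + c * w * (μ : ℕ) : ℝ) : ℂ)) * h w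
  have hk_norm : ∀ w, ‖k w‖ = ‖h w‖ := fun w => by
    simp only [k]
    rw [norm_mul, mul_comm Complex.I, Complex.norm_exp_ofReal_mul_I, one_mul]
  have hk : MemLp k 2 cell := hh.of_le_mul (c := 1)
    (AEStronglyMeasurable.mul (by fun_prop) hh.1) (.of_forall fun w => by rw [hk_norm, one_mul])
  have hab : -(c / 2) < c / 2 := by linarith
  have hP := hasSum_sq_fourierCoeffOn hab (hcell ▸ hk)
  have hba : c / 2 - -(c / 2) = c := by ring
  have hinj : Function.Injective fun s : ℤ => -2 * s + ((μ : ℕ) : ℤ) := fun s t hst => by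
    simp only at hst; omega
  rw [← hinj.tsum_eq]
  swap
  · intro n hn
    have : n % 2 = ((μ : ℕ) : ℤ) := by
      by_contra hcon
      simp [hcon] at hn
    refine ⟨-(n / 2), ?_⟩
    simp only
    omega
  have hint : ∫⁻ w, ‖h w‖ₑ ^ 2 ∂cell = ENNReal.ofReal (∫ w, ‖k w‖ ^ 2 ∂cell) := by
    rw [ofReal_integral_eq_lintegral_ofReal (hk.integrable_norm_pow (by simp))
      (.of_forall fun w => by positivity)]
    refine lintegral_congr fun w => ?_
    rw [hk_norm, ENNReal.ofReal_pow (norm_nonneg _), ofReal_norm]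
  have hval : c * ((c / 2 - -(c / 2))⁻¹ • ∫ w in -(c / 2)..c / 2, ‖k w‖ ^ 2)
      = ∫ w, ‖k w‖ ^ 2 ∂cell := by
    rw [hba, intervalIntegral.integral_of_le hab.le, hcell, smul_eq_mul]
    field_simp
  have hP' := hP.mul_left c
  rw [hval] at hP'
  rw [hint, ← hP'.tsum_eq, ENNReal.ofReal_tsum_of_nonneg (fun n => by positivity) hP'.summable]
  refine tsum_congr fun s => ?_
  have hmod : (-2 * s + ((μ : ℕ) : ℤ)) % 2 = ((μ : ℕ) : ℤ) := by
    have := μ.2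
    omega
  rw [if_pos hmod, ← ofReal_norm, ← ENNReal.ofReal_pow (norm_nonneg _)]
  congr 1
  rw [fourierCoeffOn_eq_integral, intervalIntegral.integral_of_le hab.le, ← hcell, norm_smul,
    norm_mul, mul_pow, mul_pow]
  have hcoef : ∀ w : ℝ, Complex.exp (Complex.I *
        ((a * w + c * w * ((-2 * s + ((μ : ℕ) : ℤ) : ℤ) : ℝ) : ℝ) : ℂ)) * h w
      = fourier (-s) (w : AddCircle (c / 2 - -(c / 2))) • k w := fun w => by
    rw [fourier_coe_apply, smul_eq_mul, hba]
    simp only [k]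
    rw [← mul_assoc, ← Complex.exp_add]
    congr 2
    have hpi : (Real.pi : ℂ) = c * c := by rw [← c_sq]; push_cast; ring
    have hc0 : (c : ℂ) ≠ 0 := by exact_mod_cast hc.ne'
    rw [hpi]
    field_simp
    push_cast
    ring
  simp_rw [hcoef]
  rw [← mul_assoc]
  congr 1
  rw [Complex.norm_real, Real.norm_eq_abs, Real.norm_eq_abs, sq_abs, sq_abs, hba, inv_pow,
    Real.sq_sqrt hc.le]
  field_simp

theorem lintegral_synthFun (μ : Fin 2) {f : ℝ × ℝ → ℂ} (hf : StronglyMeasurable f)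
    (h2 : ∫⁻ z, ‖f z‖ₑ ^ 2 ∂cell.prod cell < ∞) :
    ∫⁻ x, ‖synthFun μ f x‖ₑ ^ 2 = ∫⁻ z, ‖f z‖ₑ ^ 2 ∂cell.prod cell := by
  have hm := (stronglyMeasurable_synthFun μ hf).measurable
  have hfm := hf.measurable
  rw [lintegral_tile, ← lintegral_tsum (fun n => by fun_prop), lintegral_prod _ (by fun_prop)]
  refine lintegral_congr_ae ?_
  filter_upwards [slice_memLp hf h2, ae_restrict_mem measurableSet_Ico] with z hz hz'
  rw [← parseval_cell μ hz (z / 2)]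
  refine tsum_congr fun n => ?_
  unfold synthFun
  rw [nearest_add hz' n]
  split_ifs with hn
  · congr 5 with w
    congr 2
    · congr 3
      ring
    · congr 2
      ring
  · simp

theorem memLp_synthFun (μ : Fin 2) (f : Syndrome) : MemLp (synthFun μ f) 2 volume := by
  refine ⟨(stronglyMeasurable_synthFun μ (Lp.stronglyMeasurable f)).aestronglyMeasurable, ?_⟩
  have h2 := (eLpNorm_lt_top_iff_lintegral_rpow_enorm_lt_top (by simp) (by simp)).1 (Lp.memLp f).2
  rw [eLpNorm_lt_top_iff_lintegral_rpow_enorm_lt_top (by simp) (by simp)]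
  simp only [ENNReal.toReal_ofNat, ENNReal.rpow_ofNat] at h2 ⊢
  rwa [lintegral_synthFun μ (Lp.stronglyMeasurable f) h2]

/-- The isometry `f ↦ |μ⟩ ⊗ f = ∬ f(z₁, z₂) |μ; z₁, z₂⟩ dz₁ dz₂` of the syndrome subsystem into
the oscillator, which identifies the oscillator with `ℂ² ⊗ Syndrome`. -/
def ketTensor (μ : Fin 2) : Syndrome →ₗᵢ[ℂ] Mode where
  toFun f := (memLp_synthFun μ f).toLp
  map_add' f g := by
    have hslice : ∀ f : Syndrome, ∀ᵐ x : ℝ,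
        MemLp (fun w => f (x - c * nearest x, w)) 2 cell := fun f => by
      refine ae_of_cell (slice_memLp (Lp.stronglyMeasurable f) ?_)
      simpa using (eLpNorm_lt_top_iff_lintegral_rpow_enorm_lt_top (by simp) (by simp)).1
        (Lp.memLp f).2
    ext1
    filter_upwards [(memLp_synthFun μ (f + g)).coeFn_toLp, (memLp_synthFun μ f).coeFn_toLp,
      (memLp_synthFun μ g).coeFn_toLp, synthFun_congr μ (Lp.coeFn_add f g),
      Lp.coeFn_add (memLp_synthFun μ f).toLp (memLp_synthFun μ g).toLp, hslice f, hslice g]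
      with x h h₁ h₂ h₃ h₄ hf hg
    rw [h, h₄, Pi.add_apply, h₁, h₂, h₃]
    unfold synthFun
    split_ifs
    · rw [← mul_add, ← integral_add (integrable_slice hf _ (by fun_prop))
        (integrable_slice hg _ (by fun_prop))]
      simp only [Pi.add_apply, mul_add]
    · simp
  map_smul' a f := by
    ext1
    filter_upwards [(memLp_synthFun μ (a • f)).coeFn_toLp, (memLp_synthFun μ f).coeFn_toLp,
      synthFun_congr μ (Lp.coeFn_smul a f), Lp.coeFn_smul a (memLp_synthFun μ f).toLp]
      with x h h₁ h₂ h₃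
    simp only [RingHom.id_apply]
    rw [h, h₃, Pi.smul_apply, h₁, h₂]
    unfold synthFun
    split_ifs
    · rw [smul_eq_mul, mul_left_comm, ← integral_const_mul a]
      simp only [Pi.smul_apply, smul_eq_mul, mul_left_comm a]
    · simp
  norm_map' f := by
    have h2 := (eLpNorm_lt_top_iff_lintegral_rpow_enorm_lt_top (by simp) (by simp)).1
      (Lp.memLp f).2
    simp only [ENNReal.toReal_ofNat, ENNReal.rpow_ofNat] at h2
    simp only [LinearMap.coe_mk, AddHom.coe_mk]
    rw [Lp.norm_toLp, Lp.norm_def, eLpNorm_eq_lintegral_rpow_enorm_toReal (by simp) (by simp),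
      eLpNorm_eq_lintegral_rpow_enorm_toReal (by simp) (by simp)]
    simp only [ENNReal.toReal_ofNat, ENNReal.rpow_ofNat]
    rw [lintegral_synthFun μ (Lp.stronglyMeasurable f) h2]

/-- `|μ⟩ ⊗ ·` as a bounded operator; its adjoint is `⟨μ| ⊗ I`. -/
def ket (μ : Fin 2) : Syndrome →L[ℂ] Mode := (ketTensor μ).toContinuousLinearMap

/-- The filter `Π_r = ∑_μ ∬_{|z₁| < r, |z₂| < r} |μ; z₁, z₂⟩⟨μ; z₁, z₂| dz₁ dz₂`. -/
def filterOp (r : ℝ) : Mode →L[ℂ] Mode :=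
  ∑ μ : Fin 2, ket μ ∘L
    indOp (cell.prod cell) {z : ℝ × ℝ | |z.1| < r ∧ |z.2| < r} (by measurability) ∘L
    ContinuousLinearMap.adjoint (ket μ)

/-- The ideal decoder `D(T) = Tr_S T`, with entries
`⟨μ| D(T) |ν⟩ = ∬ ⟨μ; z₁, z₂| T |ν; z₁, z₂⟩ dz₁ dz₂`. -/
def decoder (T : traceClass Mode) : Matrix (Fin 2) (Fin 2) ℂ :=
  Matrix.of fun μ ν => trace (ContinuousLinearMap.adjoint (ket μ) ∘L T.1 ∘L ket ν)

/-! ### Measurements -/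

/-- The two logical Pauli bases; `Z` is read out by homodyne detection of `q`, `X` of `p`. -/
inductive Basis
  | Z
  | X

/-- The spectral measure of `q` (for `Basis.Z`) or `p` (for `Basis.X`), i.e. the POVM of ideal
homodyne detection. The momentum wave function is `(2π)^{-1/2} (𝓕 ψ)(p / 2π)`, where
`(𝓕 ψ)(ξ) = ∫ e^{-2π i x ξ} ψ(x) dx`. -/
def homodyne (b : Basis) (B : Set ℝ) (hB : MeasurableSet B) : Mode →L[ℂ] Mode :=
  match b with
  | .Z => indOp volume B hB
  | .X =>
    (Lp.fourierTransformₗᵢ ℝ ℂ).symm.toContinuousLinearEquiv.toContinuousLinearMap ∘L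
      indOp volume {ξ : ℝ | 2 * Real.pi * ξ ∈ B}
        (hB.preimage (f := fun ξ : ℝ => 2 * Real.pi * ξ) (by fun_prop)) ∘L
      (Lp.fourierTransformₗᵢ ℝ ℂ).toContinuousLinearEquiv.toContinuousLinearMap

/-- The homodyne outcomes `t` for which `⌊t/c⌉ mod 2 = μ`. -/
def bin (μ : Fin 2) : Set ℝ := {t | nearest t % 2 = ((μ : ℕ) : ℤ)}

theorem measurableSet_bin (μ : Fin 2) : MeasurableSet (bin μ) :=
  measurableSet_eq_fun (f := fun x => nearest x % 2)
    ((measurable_from_top (f := fun k : ℤ => k % 2)).comp measurable_nearest) measurable_const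

/-- The outcome distribution `μ ↦ Tr[M_μ T]` of ideal homodyne detection with GKP binning. -/
def gkpMeasurement (b : Basis) (T : traceClass Mode) (μ : Fin 2) : ℂ :=
  trace (homodyne b (bin μ) (measurableSet_bin μ) ∘L T.1)

/-- The `s`-measurement: the noise channel `N`, then homodyne detection, then binning. -/
def sMeasurement (N : traceClass Mode →ₗ[ℂ] traceClass Mode) (b : Basis)
    (T : traceClass Mode) (μ : Fin 2) : ℂ :=
  gkpMeasurement b (N T) μ

/-- The Pauli matrix of a basis. -/
def pauli : Basis → Matrix (Fin 2) (Fin 2) ℂ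
  | .Z => !![1, 0; 0, -1]
  | .X => !![0, 1; 1, 0]

/-- The outcome distribution `μ ↦ Tr[½ (1 + (-1)^μ σ) D]` of the ideal qubit Pauli measurement. -/
def qubitMeasurement (b : Basis) (D : Matrix (Fin 2) (Fin 2) ℂ) (μ : Fin 2) : ℂ :=
  ((((1 : ℂ) / 2) • (1 + ((-1 : ℂ) ^ (μ : ℕ)) • pauli b)) * D).trace

/-! ### Displacement noise -/

/-- The square `[-s, s) × [-s, s)` of allowed displacements. -/
def box (s : ℝ) : Set (ℝ × ℝ) := Ico (-s) s ×ˢ Ico (-s) s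

/-- `N` has Kraus operators that are linear combinations, possibly continuous ones (limits in the
weak operator topology), of the displacements in the square. -/
def HasDisplacementKraus (s : ℝ) (N : traceClass Mode →ₗ[ℂ] traceClass Mode) : Prop :=
  ∃ K : ℕ → (Mode →L[ℂ] Mode),
    (∀ i, ContinuousLinearMapWOT.ofCLM (K i) ∈
      (Submodule.span ℂ {A : Mode →WOT[ℂ] Mode | ∃ z ∈ box s,
        A = ContinuousLinearMapWOT.ofCLM (displacement z.1 z.2)}).topologicalClosure) ∧
    ∀ (T : traceClass Mode) (φ ψ : Mode),
      HasSum (fun i => ⟪φ, K i (T.1 (ContinuousLinearMap.adjoint (K i) ψ))⟫_ℂ) ⟪φ, (N T).1 ψ⟫_ℂ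

/-- `N(T) = ∫ 𝓔(z, z') V(z) T V(z')† d(z, z')` with a kernel supported on the square in both
variables. The reference measure `m` is Lebesgue measure for a kernel that is a function; other
choices give kernels that are complex measures, such as finite sums. -/
def HasDisplacementKernel (s : ℝ) (N : traceClass Mode →ₗ[ℂ] traceClass Mode) : Prop :=
  ∃ (m : Measure ((ℝ × ℝ) × (ℝ × ℝ))) (𝓔 : (ℝ × ℝ) × (ℝ × ℝ) → ℂ),
    Integrable 𝓔 m ∧ (∀ w, 𝓔 w ≠ 0 → w.1 ∈ box s ∧ w.2 ∈ box s) ∧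
    ∀ (T : traceClass Mode) (φ ψ : Mode),
      ⟪φ, (N T).1 ψ⟫_ℂ = ∫ w, 𝓔 w * ⟪φ, displacement w.1.1 w.1.2
        (T.1 (ContinuousLinearMap.adjoint (displacement w.2.1 w.2.2) ψ))⟫_ℂ ∂m

/-- `s`-parameterized noise channels. -/
def IsNoiseChannel (s : ℝ) (N : traceClass Mode →ₗ[ℂ] traceClass Mode) : Prop :=
  IsChannel N ∧ (HasDisplacementKraus s N ∨ HasDisplacementKernel s N)

end

end GKP

namespace GKP

/-! ### Trace-class operators: convergence and cyclicity of the trace. -/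

section Trace

/-! The filter `Π_r` acts as the identity on the qubit tensor `window r`, so in either Pauli
eigenbasis it is the sum of its parts `P_ν = filterPart b r ν`. The heart of the proof is that a
displacement `V(v)` with `v ∈ box s` moves the relevant quadrature of a windowed eigenstate `|ν⟩ ⊗
f` by at most `s`. Its homodyne distribution therefore stays within `r + s < c / 2` of multiples of
`c` of parity `ν`, and the binned projection `M_μ` acts on it as `1` or `0`
(`homodyne_displacement_basisKet`). Hence `M_μ V(v) Π_r = V(v) P_μ`.

For `Z` this is read off the support of the wave function. For `X` the momentum wave function is
never computed. The Fourier coefficients of the distribution of `p` modulo `2c` are expectations of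
translations by multiples of `c`, and on a displaced eigenstate these act as characters evaluated at
`z₂ + c ν + v₂` (`displacement_displacement_basisKet_X`). So `p` modulo `2c` is distributed like `z₂
+ c ν + v₂`, and uniqueness of Fourier coefficients transfers the support
(`ae_eq_zero_of_fourier_moments_eq`).

The operator identity is linear and weakly closed in the displacement, so it extends to Kraus
operators, and it can be applied under the integral for kernels. It touches only the factor to the
left of the state, which gives `M_μ N(Π ρ Π†) = N(P_μ ρ Π†)` (`readout_comp_noise`). Trace
preservation removes `N`, and cyclicity identifies what is left with the qubit probability
(`qubitMeasurement_decoder`). -/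

theorem tsum_norm_inner_mul_inner_le {E : Type} [NormedAddCommGroup E]
    [InnerProductSpace ℂ E] {ι : Type*} (e : HilbertBasis ι ℂ E) (x y : E) :
    Summable (fun i => ‖⟪y, e i⟫_ℂ * ⟪e i, x⟫_ℂ‖) ∧
      ∑' i, ‖⟪y, e i⟫_ℂ * ⟪e i, x⟫_ℂ‖ ≤ ‖x‖ * ‖y‖ := by
  have hB : ∀ z : E, HasSum (fun i => ‖⟪e i, z⟫_ℂ‖ ^ (2 : ℝ)) (‖z‖ ^ 2) := fun z => by
    have h := (e.hasSum_inner_mul_inner z z).mapL Complex.reCLM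
    have h2 : Complex.reCLM ⟪z, z⟫_ℂ = ‖z‖ ^ 2 := by
      rw [inner_self_eq_norm_sq_to_K]; norm_cast
    rw [h2] at h
    convert! h using 2 with i
    rw [← inner_conj_symm z, Complex.reCLM_apply, ← Complex.normSq_eq_conj_mul_self,
      Complex.ofReal_re, Complex.normSq_eq_norm_sq]
    norm_cast
  have hy := hB y
  have hx := hB x
  have := Real.inner_le_Lp_mul_Lq_tsum_of_nonneg (p := 2) (q := 2)
    Real.HolderConjugate.two_two
    (f := fun i => ‖⟪e i, x⟫_ℂ‖) (g := fun i => ‖⟪e i, y⟫_ℂ‖)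
    (fun i => norm_nonneg _) (fun i => norm_nonneg _) hx.summable hy.summable
  have hs : ∀ z : E, (‖z‖ ^ 2) ^ (1 / 2 : ℝ) = ‖z‖ := fun z => by
    rw [← Real.sqrt_eq_rpow, Real.sqrt_sq (norm_nonneg _)]
  rw [hx.tsum_eq, hy.tsum_eq, hs, hs] at this
  have hcomm : ∀ i, ‖⟪y, e i⟫_ℂ * ⟪e i, x⟫_ℂ‖ = ‖⟪e i, x⟫_ℂ‖ * ‖⟪e i, y⟫_ℂ‖ := fun i => by
    rw [norm_mul, norm_inner_symm y, mul_comm]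
  simp_rw [hcomm]
  exact ⟨by simpa only [hcomm] using (e.summable_inner_mul_inner y x).norm, this⟩

/-- Fubini for the double series `⟪y n, e i⟫ ⟪e i, x n⟫`, absolutely summable by Cauchy–Schwarz and
Parseval: summing over `i` first gives `⟪y n, x n⟫`, summing over `n` first gives the diagonal
entries. The value does not involve `e`, so the trace is independent of the basis. -/
theorem hasSum_diagonal_of_repr {E : Type} [NormedAddCommGroup E]
    [InnerProductSpace ℂ E] {ι : Type*} (e : HilbertBasis ι ℂ E) {T : E →L[ℂ] E} {x y : ℕ → E}
    (hs : Summable (fun n => ‖x n‖ * ‖y n‖)) (h : ∀ v, HasSum (fun n => ⟪y n, v⟫_ℂ • x n) (T v)) :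
    HasSum (fun i => ⟪e i, T (e i)⟫_ℂ) (∑' n, ⟪y n, x n⟫_ℂ) := by
  have hsum : Summable (fun p : ℕ × ι => ⟪y p.1, e p.2⟫_ℂ * ⟪e p.2, x p.1⟫_ℂ) := by
    refine Summable.of_norm ((summable_prod_of_nonneg fun p => norm_nonneg _).2
      ⟨fun n => (tsum_norm_inner_mul_inner_le e (x n) (y n)).1, ?_⟩)
    exact Summable.of_nonneg_of_le (fun n => tsum_nonneg fun i => norm_nonneg _)
      (fun n => (tsum_norm_inner_mul_inner_le e (x n) (y n)).2) hs
  have hrow : ∀ n, HasSum (fun i => ⟪y n, e i⟫_ℂ * ⟪e i, x n⟫_ℂ) ⟪y n, x n⟫_ℂ := fun n =>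
    e.hasSum_inner_mul_inner (y n) (x n)
  have hcol : ∀ i, HasSum (fun n => ⟪y n, e i⟫_ℂ * ⟪e i, x n⟫_ℂ) ⟪e i, T (e i)⟫_ℂ := fun i => by
    simpa [inner_smul_right] using (h (e i)).mapL (innerSL ℂ (e i))
  have htot := hsum.hasSum
  rw [← (htot.prod_fiberwise hrow).tsum_eq] at htot
  exact (((Equiv.prodComm ι ℕ).hasSum_iff (f := fun p : ℕ × ι =>
    ⟪y p.1, e p.2⟫_ℂ * ⟪e p.2, x p.1⟫_ℂ)).2 htot).prod_fiberwise hcol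

variable {E F : Type} [NormedAddCommGroup E] [InnerProductSpace ℂ E] [CompleteSpace E]
  [NormedAddCommGroup F] [InnerProductSpace ℂ F] [CompleteSpace F]

theorem trace_eq_of_repr {T : E →L[ℂ] E} {x y : ℕ → E}
    (hs : Summable (fun n => ‖x n‖ * ‖y n‖)) (h : ∀ v, HasSum (fun n => ⟪y n, v⟫_ℂ • x n) (T v)) :
    trace T = ∑' n, ⟪y n, x n⟫_ℂ :=
  (hasSum_diagonal_of_repr _ hs h).tsum_eq

theorem hasSum_trace {T : E →L[ℂ] E} (hT : T ∈ traceClass E) :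
    HasSum (fun i => ⟪(exists_hilbertBasis ℂ E).choose_spec.choose i,
      T ((exists_hilbertBasis ℂ E).choose_spec.choose i)⟫_ℂ) (trace T) := by
  obtain ⟨x, y, hs, h⟩ := hT
  rw [trace_eq_of_repr hs h]
  exact hasSum_diagonal_of_repr _ hs h

theorem trace_add {S T : E →L[ℂ] E} (hS : S ∈ traceClass E) (hT : T ∈ traceClass E) :
    trace (S + T) = trace S + trace T := by
  rw [← ((hasSum_trace hS).add (hasSum_trace hT)).tsum_eq]
  simp only [trace, add_apply, inner_add_right]

theorem trace_smul (a : ℂ) (T : E →L[ℂ] E) :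
    trace (a • T) = a * trace T := by
  simp only [trace, smul_apply, inner_smul_right, tsum_mul_left]

/-- Both traces are the same series, since `⟪B† yₙ, A xₙ⟫ = ⟪yₙ, B A xₙ⟫`. Two spaces are needed
because the decoder passes from the mode to the syndrome. -/
theorem comp_comp_mem_traceClass_and_trace {T : E →L[ℂ] E} (hT : T ∈ traceClass E)
    (A : E →L[ℂ] F) (B : F →L[ℂ] E) :
    A ∘L T ∘L B ∈ traceClass F ∧ trace (A ∘L T ∘L B) = trace (B ∘L A ∘L T) := by
  obtain ⟨x, y, hs, h⟩ := hT
  have hs1 : Summable (fun n => ‖A (x n)‖ * ‖ContinuousLinearMap.adjoint B (y n)‖) := by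
    refine Summable.of_nonneg_of_le (fun n => by positivity) (fun n => ?_)
      (hs.mul_left (‖A‖ * ‖ContinuousLinearMap.adjoint B‖))
    calc ‖A (x n)‖ * ‖ContinuousLinearMap.adjoint B (y n)‖
        ≤ (‖A‖ * ‖x n‖) * (‖ContinuousLinearMap.adjoint B‖ * ‖y n‖) := by
          gcongr <;> exact ContinuousLinearMap.le_opNorm _ _
      _ = _ := by ring
  have hs2 : Summable (fun n => ‖B (A (x n))‖ * ‖y n‖) := by
    refine Summable.of_nonneg_of_le (fun n => by positivity) (fun n => ?_)
      (hs.mul_left ‖B ∘L A‖)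
    rw [← mul_assoc]
    gcongr
    exact (B ∘L A).le_opNorm _
  have h1 : ∀ v, HasSum (fun n => ⟪ContinuousLinearMap.adjoint B (y n), v⟫_ℂ • A (x n))
      ((A ∘L T ∘L B) v) := fun v => by
    simpa [ContinuousLinearMap.adjoint_inner_left] using (h (B v)).mapL A
  have h2 : ∀ v, HasSum (fun n => ⟪y n, v⟫_ℂ • B (A (x n))) ((B ∘L A ∘L T) v) := fun v => by
    simpa using (h v).mapL (B ∘L A)
  refine ⟨⟨_, _, hs1, h1⟩, ?_⟩
  rw [trace_eq_of_repr hs1 h1, trace_eq_of_repr hs2 h2]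
  simp only [ContinuousLinearMap.adjoint_inner_left]

theorem comp_comp_mem_traceClass {T : E →L[ℂ] E} (hT : T ∈ traceClass E) (A : E →L[ℂ] F)
    (B : F →L[ℂ] E) : A ∘L T ∘L B ∈ traceClass F :=
  (comp_comp_mem_traceClass_and_trace hT A B).1

theorem trace_comp_cycle {T : E →L[ℂ] E} (hT : T ∈ traceClass E) (A : E →L[ℂ] F)
    (B : F →L[ℂ] E) : trace (A ∘L T ∘L B) = trace (B ∘L A ∘L T) :=
  (comp_comp_mem_traceClass_and_trace hT A B).2

theorem comp_mem_traceClass (A : E →L[ℂ] E) {T : E →L[ℂ] E} (hT : T ∈ traceClass E) :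
    A ∘L T ∈ traceClass E := by
  simpa using comp_comp_mem_traceClass hT A (.id ℂ E)

end Trace

/-! ### Measures on the circle and their Fourier coefficients. -/

section Circle

/-- Trigonometric polynomials are dense in the continuous functions, and integration against a
finite measure is Lipschitz for the sup norm. -/
theorem measure_addCircle_ext {T : ℝ} [Fact (0 < T)] {P Q : Measure (AddCircle T)}
    [IsFiniteMeasure P] [IsFiniteMeasure Q]
    (h : ∀ n : ℤ, ∫ x, fourier n x ∂P = ∫ x, fourier n x ∂Q) : P = Q := by
  have hint : ∀ (κ : Measure (AddCircle T)) [IsFiniteMeasure κ] (g : C(AddCircle T, ℂ)),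
      Integrable g κ := fun κ _ g =>
    (BoundedContinuousFunction.mkOfCompact g).integrable κ
  have hcont : ∀ (κ : Measure (AddCircle T)) [IsFiniteMeasure κ],
      Continuous (fun g : C(AddCircle T, ℂ) => ∫ x, g x ∂κ) := fun κ _ => by
    refine (LipschitzWith.of_dist_le_mul (K := (κ univ).toNNReal) fun g k => ?_).continuous
    rw [dist_eq_norm, dist_eq_norm, ← integral_sub (hint κ g) (hint κ k)]
    refine (norm_integral_le_of_norm_le_const (C := ‖g - k‖)
      (.of_forall fun x => (g - k).norm_coe_le_norm x)).trans_eq ?_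
    rw [mul_comm]; rfl
  have hall : ∀ g : C(AddCircle T, ℂ), ∫ x, g x ∂P = ∫ x, g x ∂Q := fun g => by
    have hg : g ∈ closure (Submodule.span ℂ (range <| @fourier T) : Set C(AddCircle T, ℂ)) := by
      rw [← Submodule.topologicalClosure_coe, span_fourier_closure_eq_top]; trivial
    refine closure_minimal (s := (Submodule.span ℂ (range <| @fourier T) : Set _))
      (t := {g : C(AddCircle T, ℂ) | ∫ x, g x ∂P = ∫ x, g x ∂Q}) (fun k hk => ?_)
      (isClosed_eq (hcont P) (hcont Q)) hg
    refine Submodule.span_induction ?_ ?_ ?_ ?_ hk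
    · rintro _ ⟨n, rfl⟩
      exact h n
    · simp
    · intro a b _ _ ha hb
      simp only [mem_ofPred_eq, ContinuousMap.add_apply] at ha hb ⊢
      rw [integral_add (hint P a) (hint P b), integral_add (hint Q a) (hint Q b), ha, hb]
    · intro z a _ ha
      simp only [mem_ofPred_eq, ContinuousMap.smul_apply, integral_smul] at ha ⊢
      rw [ha]
  refine ext_of_forall_integral_eq_of_IsFiniteMeasure fun g => ?_
  have := hall ⟨fun x => (g x : ℂ), by fun_prop⟩
  simp only [ContinuousMap.coe_mk] at this
  rw [integral_complex_ofReal, integral_complex_ofReal] at this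
  exact_mod_cast this

/-- Square-integrable functions whose densities push forward to measures on the circle with the same
Fourier coefficients vanish over the same sets. -/
theorem ae_eq_zero_of_fourier_moments_eq {T : ℝ} [Fact (0 < T)] {α β : Type} [MeasurableSpace α]
    [MeasurableSpace β] {m : Measure α} {m' : Measure β} {u : α → AddCircle T}
    {w : β → AddCircle T} (hu : Measurable u) (hw : Measurable w) (f : Lp ℂ 2 m) (g : Lp ℂ 2 m')
    (h : ∀ n : ℤ, ∫ x, fourier n (u x) * ((‖f x‖ ^ 2 : ℝ) : ℂ) ∂m
      = ∫ y, fourier n (w y) * ((‖g y‖ ^ 2 : ℝ) : ℂ) ∂m')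
    {A : Set (AddCircle T)} (hA : MeasurableSet A) (hg : ∀ᵐ y ∂m', w y ∈ A → g y = 0) :
    ∀ᵐ x ∂m, u x ∈ A → f x = 0 := by
  -- The measure is the push-forward of `‖q‖² k` under `v`, finite because `q` is square-integrable;
  -- it is null on `A` exactly when `q` vanishes almost everywhere on `v ⁻¹' A`.
  have key : ∀ {γ : Type} [MeasurableSpace γ] (k : Measure γ) (v : γ → AddCircle T)
      (_ : Measurable v) (q : Lp ℂ 2 k),
      ∃ P : Measure (AddCircle T), IsFiniteMeasure P ∧
        (∀ n : ℤ, ∫ x, fourier n x ∂P = ∫ x, fourier n (v x) * ((‖q x‖ ^ 2 : ℝ) : ℂ) ∂k) ∧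
        (P A = 0 ↔ ∀ᵐ x ∂k, v x ∈ A → q x = 0) := fun {γ} _ k v hv q => by
    have hqm : Measurable q := (Lp.stronglyMeasurable q).measurable
    have hdm : Measurable fun x => (‖q x‖₊ ^ 2 : NNReal) := by fun_prop
    have hfin : IsFiniteMeasure (k.withDensity fun x => ((‖q x‖₊ ^ 2 : NNReal) : ℝ≥0∞)) := by
      refine isFiniteMeasure_withDensity ?_
      have h2 := (eLpNorm_lt_top_iff_lintegral_rpow_enorm_lt_top (by simp) (by simp)).1
        (Lp.memLp q).2
      simpa [enorm] using h2.ne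
    refine ⟨(k.withDensity fun x => ((‖q x‖₊ ^ 2 : NNReal) : ℝ≥0∞)).map v, inferInstance,
      fun n => ?_, ?_⟩
    · rw [integral_map hv.aemeasurable (by fun_prop), integral_withDensity_eq_integral_smul hdm]
      refine integral_congr_ae (.of_forall fun x => ?_)
      simp only [NNReal.smul_def, Complex.real_smul]
      push_cast
      ring
    · rw [Measure.map_apply hv hA, withDensity_apply _ (hv hA),
        lintegral_eq_zero_iff (by fun_prop), Filter.EventuallyEq, ae_restrict_iff' (hv hA)]
      simp
  obtain ⟨P, hP, hPf, hPA⟩ := key m u hu f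
  obtain ⟨Q, hQ, hQf, hQA⟩ := key m' w hw g
  have hPQ : P = Q := measure_addCircle_ext fun n => by rw [hPf, hQf, h]
  rw [← hPA, hPQ, hQA]
  exact hg

end Circle

/-! ### Multiplication operators. -/

section Multiplication

variable {α : Type} [MeasurableSpace α] {m : Measure α}

theorem coeFn_mulOp (g : α → ℂ) (hg : Measurable g) (hb : ∀ x, ‖g x‖ ≤ 1) (f : Lp ℂ 2 m) :
    mulOp m g hg hb f =ᵐ[m] fun x => g x * f x :=
  ((Lp.memLp f).of_le_mul (c := 1)
    (hg.aestronglyMeasurable.mul (Lp.aestronglyMeasurable f)) (.of_forall fun x => by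
      rw [norm_mul]; gcongr; exact hb x) : MemLp (fun x => g x * f x) 2 m).coeFn_toLp

theorem coeFn_indOp {B : Set α} (hB : MeasurableSet B) (f : Lp ℂ 2 m) :
    indOp m B hB f =ᵐ[m] B.indicator f := by
  refine (coeFn_mulOp _ _ _ f).trans (.of_forall fun x => ?_)
  by_cases h : x ∈ B <;> simp [h]

theorem inner_mulOp_self (g : α → ℂ) (hg : Measurable g) (hb : ∀ x, ‖g x‖ ≤ 1) (f : Lp ℂ 2 m) :
    ⟪f, mulOp m g hg hb f⟫_ℂ = ∫ x, g x * ((‖f x‖ ^ 2 : ℝ) : ℂ) ∂m := by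
  rw [L2.inner_def]
  refine integral_congr_ae ?_
  filter_upwards [coeFn_mulOp g hg hb f] with x hx
  rw [hx, RCLike.inner_apply, mul_assoc, Complex.mul_conj, Complex.normSq_eq_norm_sq]

end Multiplication

/-! ### Displacements and their Fourier transforms. -/

theorem coeFn_displacement (v₁ v₂ : ℝ) (f : Mode) :
    displacement v₁ v₂ f =ᵐ[volume] fun x =>
      Complex.exp (Complex.I * ((v₂ * x - v₁ * v₂ / 2 : ℝ) : ℂ)) * f (x - v₁) := by
  have h : Lp.compMeasurePreservingₗᵢ ℂ (fun x : ℝ => x - v₁)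
      (measurePreserving_sub_right volume v₁) f =ᵐ[volume] fun x => f (x - v₁) :=
    Lp.coeFn_compMeasurePreserving f (measurePreserving_sub_right volume v₁)
  filter_upwards [h, coeFn_mulOp (m := volume)
    (fun x : ℝ => Complex.exp (Complex.I * ((v₂ * x - v₁ * v₂ / 2 : ℝ) : ℂ))) (by fun_prop)
    (fun x => by rw [mul_comm, Complex.norm_exp_ofReal_mul_I])
    (Lp.compMeasurePreservingₗᵢ ℂ (fun x : ℝ => x - v₁)
    (measurePreserving_sub_right volume v₁) f)] with x hx hx'
  rw [← hx]
  exact hx'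

theorem norm_displacement (v₁ v₂ : ℝ) (f : Mode) : ‖displacement v₁ v₂ f‖ = ‖f‖ := by
  rw [← (Lp.compMeasurePreservingₗᵢ ℂ (fun x : ℝ => x - v₁)
    (measurePreserving_sub_right volume v₁)).norm_map f, Lp.norm_def, Lp.norm_def]
  congr 1
  refine eLpNorm_congr_norm_ae ?_
  filter_upwards [coeFn_mulOp (m := volume)
    (fun x : ℝ => Complex.exp (Complex.I * ((v₂ * x - v₁ * v₂ / 2 : ℝ) : ℂ))) (by fun_prop)
    (fun x => by rw [mul_comm, Complex.norm_exp_ofReal_mul_I])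
    (Lp.compMeasurePreservingₗᵢ ℂ (fun x : ℝ => x - v₁)
    (measurePreserving_sub_right volume v₁) f)] with x hx
  rw [displacement, ContinuousLinearMap.comp_apply]
  refine (congrArg norm hx).trans ?_
  rw [norm_mul, mul_comm Complex.I, Complex.norm_exp_ofReal_mul_I, one_mul]

/-- Multiplication by the phase `exp (-2πi a ξ)`. -/
noncomputable def modulation (a : ℝ) : Mode →L[ℂ] Mode :=
  mulOp volume (fun ξ : ℝ => Complex.exp (Complex.I * ((-(2 * Real.pi * a * ξ) : ℝ) : ℂ)))
    (by fun_prop) (fun x => by rw [mul_comm, Complex.norm_exp_ofReal_mul_I])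

theorem displacement_zero_toLp (a : ℝ) (φ : SchwartzMap ℝ ℂ) :
    displacement a 0 (φ.toLp 2) = (φ.compSubConstCLM ℂ a).toLp 2 := by
  ext1
  filter_upwards [coeFn_displacement a 0 (φ.toLp 2), (φ.compSubConstCLM ℂ a).coeFn_toLp 2,
    (measurePreserving_sub_right volume a).quasiMeasurePreserving.ae (φ.coeFn_toLp 2 volume)]
    with x h1 h2 h3
  rw [h1, h2, h3]
  simp

theorem fourier_compSubConst_apply (a ξ : ℝ) (φ : SchwartzMap ℝ ℂ) :
    FourierTransform.fourier (φ.compSubConstCLM ℂ a) ξ =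
      Complex.exp (Complex.I * ((-(2 * Real.pi * a * ξ) : ℝ) : ℂ)) *
        FourierTransform.fourier φ ξ := by
  rw [SchwartzMap.fourier_coe, SchwartzMap.fourier_coe, Real.fourier_eq', Real.fourier_eq',
    ← integral_add_right_eq_self _ a, ← integral_const_mul]
  refine integral_congr_ae (.of_forall fun x => ?_)
  simp only [SchwartzMap.compSubConstCLM_apply, smul_eq_mul, ← mul_assoc, ← Complex.exp_add,
    add_sub_cancel_right]
  congr 2
  simp only [RCLike.inner_apply, conj_trivial]
  push_cast
  ring

theorem modulation_toLp (a : ℝ) (φ : SchwartzMap ℝ ℂ) :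
    modulation a ((FourierTransform.fourier φ).toLp 2) =
      (FourierTransform.fourier (φ.compSubConstCLM ℂ a)).toLp 2 := by
  have h3 := coeFn_mulOp (m := volume) (fun ξ : ℝ =>
      Complex.exp (Complex.I * ((-(2 * Real.pi * a * ξ) : ℝ) : ℂ)))
        (by fun_prop) (fun x => by rw [mul_comm, Complex.norm_exp_ofReal_mul_I])
        ((FourierTransform.fourier φ).toLp 2 volume)
  ext1
  filter_upwards [(FourierTransform.fourier (φ.compSubConstCLM ℂ a)).coeFn_toLp 2 volume,
    (FourierTransform.fourier φ).coeFn_toLp 2 volume, h3] with ξ h1 h2 h3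
  rw [h1, fourier_compSubConst_apply, ← h2]
  exact h3

/-- The Fourier transform turns translations into modulations. -/
theorem fourierTransform_displacement_zero (a : ℝ) (f : Mode) :
    Lp.fourierTransformₗᵢ ℝ ℂ (displacement a 0 f) =
      modulation a (Lp.fourierTransformₗᵢ ℝ ℂ f) := by
  have h2 : ∀ ψ : SchwartzMap ℝ ℂ, Lp.fourierTransformₗᵢ ℝ ℂ (ψ.toLp 2)
      = (FourierTransform.fourier ψ).toLp 2 := SchwartzMap.toLp_fourier_eq
  refine DenseRange.induction_on (p := fun f : Mode =>
    Lp.fourierTransformₗᵢ ℝ ℂ (displacement a 0 f)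
      = modulation a (Lp.fourierTransformₗᵢ ℝ ℂ f))
    (SchwartzMap.denseRange_toLpCLM (E := ℝ) (F := ℂ) (μ := volume)
      (p := 2) ENNReal.ofNat_ne_top) f ?_ ?_
  · refine isClosed_eq ?_ ?_
    · exact (Lp.fourierTransformₗᵢ ℝ ℂ).continuous.comp (displacement a 0).continuous
    · exact (modulation a).continuous.comp (Lp.fourierTransformₗᵢ ℝ ℂ).continuous
  intro φ
  simp only [SchwartzMap.toLpCLM_apply]
  rw [displacement_zero_toLp, h2, h2, modulation_toLp]

/-! ### Pauli eigenstates tensored with the syndrome, the filter and the decoder. -/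

section Ket

theorem coeFn_ket (μ : Fin 2) (f : Syndrome) : ket μ f =ᵐ[volume] synthFun μ f :=
  (memLp_synthFun μ f).coeFn_toLp

theorem inner_ket_same (μ : Fin 2) (f g : Syndrome) : ⟪ket μ f, ket μ g⟫_ℂ = ⟪f, g⟫_ℂ :=
  (ketTensor μ).inner_map_map f g

/-- The two wave functions live on cells of opposite parity. -/
theorem inner_ket_of_ne {μ ν : Fin 2} (h : μ ≠ ν) (f g : Syndrome) :
    ⟪ket μ f, ket ν g⟫_ℂ = 0 := by
  rw [L2.inner_def]
  refine integral_eq_zero_of_ae ?_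
  filter_upwards [coeFn_ket μ f, coeFn_ket ν g] with x h1 h2
  rw [h1, h2]
  unfold synthFun
  split_ifs with h3 h4
  · exact absurd (Fin.ext (by rw [h3] at h4; exact_mod_cast h4)) h
  all_goals simp

theorem adjoint_ket_ket (μ ν : Fin 2) (f : Syndrome) :
    ContinuousLinearMap.adjoint (ket μ) (ket ν f) = if μ = ν then f else 0 := by
  refine ext_inner_left ℂ fun g => ?_
  rw [ContinuousLinearMap.adjoint_inner_right]
  split_ifs with h
  · rw [h, inner_ket_same]
  · rw [inner_ket_of_ne h, inner_zero_right]

/-- The constant `1 / √2`. -/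
noncomputable def invSqrtTwo : ℂ := ((√2)⁻¹ : ℝ)

theorem invSqrtTwo_mul_self : invSqrtTwo * invSqrtTwo = 1 / 2 := by
  rw [invSqrtTwo, ← Complex.ofReal_mul, ← mul_inv, Real.mul_self_sqrt (by norm_num)]
  norm_num

theorem star_invSqrtTwo : star invSqrtTwo = invSqrtTwo := Complex.conj_ofReal _

/-- The isometry `f ↦ |ν⟩ ⊗ f` for the eigenvector `|ν⟩` of the Pauli operator of a basis with
eigenvalue `(-1)^ν`. -/
noncomputable def basisKet : Basis → Fin 2 → Syndrome →L[ℂ] Mode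
  | .Z, ν => ket ν
  | .X, ν => invSqrtTwo • (ket 0 + (-1 : ℂ) ^ (ν : ℕ) • ket 1)

theorem adjoint_basisKet_X (ν : Fin 2) (φ : Mode) :
    ContinuousLinearMap.adjoint (basisKet .X ν) φ = invSqrtTwo •
      (ContinuousLinearMap.adjoint (ket 0) φ +
        (-1 : ℂ) ^ (ν : ℕ) • ContinuousLinearMap.adjoint (ket 1) φ) := by
  have h : star ((-1 : ℂ) ^ (ν : ℕ)) = (-1) ^ (ν : ℕ) := by simp
  refine ext_inner_left ℂ fun g => ?_
  simp only [basisKet, ContinuousLinearMap.adjoint_inner_right, smul_apply, add_apply,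
    inner_smul_left, inner_smul_right, inner_add_left, inner_add_right, starRingEnd_apply, h,
    star_invSqrtTwo]

theorem adjoint_basisKet_basisKet (b : Basis) (μ ν : Fin 2) (f : Syndrome) :
    ContinuousLinearMap.adjoint (basisKet b μ) (basisKet b ν f) = if μ = ν then f else 0 := by
  cases b
  · exact adjoint_ket_ket μ ν f
  · rw [adjoint_basisKet_X]
    have h := invSqrtTwo_mul_self
    simp only [basisKet, smul_apply, add_apply, map_smul, map_add, adjoint_ket_ket]
    fin_cases μ <;> fin_cases ν <;> simp <;> match_scalars <;>
      first | ring1 | linear_combination 2 * h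

theorem inner_basisKet (b : Basis) (ν : Fin 2) (f g : Syndrome) :
    ⟪basisKet b ν f, basisKet b ν g⟫_ℂ = ⟪f, g⟫_ℂ := by
  rw [← ContinuousLinearMap.adjoint_inner_right, adjoint_basisKet_basisKet, if_pos rfl]

/-- The restriction of the syndrome to the square `|z₁|, |z₂| < r`. -/
noncomputable def window (r : ℝ) : Syndrome →L[ℂ] Syndrome :=
  indOp (cell.prod cell) {z : ℝ × ℝ | |z.1| < r ∧ |z.2| < r} (by measurability)

/-- The part of the filter `Π_r` with logical state `|ν⟩`. -/
noncomputable def filterPart (b : Basis) (r : ℝ) (ν : Fin 2) : Mode →L[ℂ] Mode :=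
  basisKet b ν ∘L window r ∘L ContinuousLinearMap.adjoint (basisKet b ν)

/-- The eigenprojections of either Pauli operator sum to the identity of the qubit; for `X` the
cross terms between `ket 0` and `ket 1` cancel. -/
theorem filterOp_eq_sum (b : Basis) (r : ℝ) : filterOp r = ∑ ν, filterPart b r ν := by
  cases b
  · rfl
  · have h := invSqrtTwo_mul_self
    ext1 φ
    change (∑ μ : Fin 2, ket μ ∘L window r ∘L ContinuousLinearMap.adjoint (ket μ)) φ = _
    simp only [filterPart, Fin.sum_univ_two, add_apply, ContinuousLinearMap.comp_apply,
      adjoint_basisKet_X, map_smul, map_add]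
    simp only [basisKet, smul_apply, add_apply]
    simp only [Fin.val_zero, Fin.val_one, pow_zero, pow_one, smul_add, smul_smul]
    match_scalars <;> first | ring1 | linear_combination (-2) * h

theorem adjoint_basisKet_filterOp (b : Basis) (r : ℝ) (μ : Fin 2) :
    ContinuousLinearMap.adjoint (basisKet b μ) ∘L filterOp r =
      window r ∘L ContinuousLinearMap.adjoint (basisKet b μ) := by
  ext1 φ
  rw [filterOp_eq_sum b r]
  simp only [filterPart, Fin.sum_univ_two, ContinuousLinearMap.comp_apply, add_apply, map_add,
    adjoint_basisKet_basisKet]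
  fin_cases μ <;> simp

/-- The defining property of the partial trace, `Tr[P D(T)] = Tr[(P ⊗ I) T]`, with `P` the
projection onto the eigenvector labelled `μ`. -/
theorem qubitMeasurement_decoder (b : Basis) (T : traceClass Mode) (μ : Fin 2) :
    qubitMeasurement b (decoder T) μ =
      trace ((basisKet b μ ∘L ContinuousLinearMap.adjoint (basisKet b μ)) ∘L T.1) := by
  -- Cyclicity moves the traces from the syndrome to the mode, where they can be added.
  have hd : ∀ i j, decoder T i j =
      trace ((ket j ∘L ContinuousLinearMap.adjoint (ket i)) ∘L T.1) := fun i j => by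
    rw [decoder, Matrix.of_apply, trace_comp_cycle T.2, ContinuousLinearMap.comp_assoc]
  cases b
  · simp only [qubitMeasurement, pauli, Matrix.trace, Matrix.diag, Matrix.mul_apply,
      Fin.sum_univ_two, hd]
    fin_cases μ <;> simp [basisKet] <;> ring
  · have h := invSqrtTwo_mul_self
    have hm : ∀ i j, (ket j ∘L ContinuousLinearMap.adjoint (ket i)) ∘L T.1 ∈ traceClass Mode :=
      fun i j => comp_mem_traceClass _ T.2
    have he : (basisKet .X μ ∘L ContinuousLinearMap.adjoint (basisKet .X μ)) ∘L T.1 =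
        (1 / 2 : ℂ) • ((((ket 0 ∘L ContinuousLinearMap.adjoint (ket 0)) ∘L T.1) +
          ((ket 1 ∘L ContinuousLinearMap.adjoint (ket 1)) ∘L T.1)) + (-1 : ℂ) ^ (μ : ℕ) •
          (((ket 0 ∘L ContinuousLinearMap.adjoint (ket 1)) ∘L T.1) +
          ((ket 1 ∘L ContinuousLinearMap.adjoint (ket 0)) ∘L T.1))) := by
      ext1 φ
      simp only [ContinuousLinearMap.comp_apply, add_apply, smul_apply, adjoint_basisKet_X, ← h]
      simp only [basisKet, smul_apply, add_apply, map_smul, map_add]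
      rcases neg_one_pow_eq_or ℂ (μ : ℕ) with h' | h' <;> rw [h'] <;> module
    rw [he, trace_smul, trace_add (add_mem (hm 0 0) (hm 1 1))
      (Submodule.smul_mem _ _ (add_mem (hm 1 0) (hm 0 1))), trace_smul, trace_add (hm 0 0) (hm 1 1),
      trace_add (hm 1 0) (hm 0 1)]
    simp only [qubitMeasurement, pauli, Matrix.trace, Matrix.diag, Matrix.mul_apply,
      Fin.sum_univ_two, hd]
    simp
    ring

end Ket

/-! ### Position readout of displaced filtered states. -/

section Spectral

theorem mem_bin_iff {t : ℝ} {μ ν : Fin 2} (h : nearest t % 2 = ((ν : ℕ) : ℤ)) :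
    t ∈ bin μ ↔ μ = ν := by
  rw [bin, mem_ofPred_eq, h, Fin.ext_iff, Nat.cast_inj, eq_comm]

/-- Since `p` does not depend on the point, `B` either contains or misses the support of `f`, up to
a null set. -/
theorem indOp_eq_ite {α : Type} [MeasurableSpace α] {m : Measure α} {B : Set α}
    (hB : MeasurableSet B) (p : Prop) [Decidable p] (f : Lp ℂ 2 m)
    (h : ∀ᵐ x ∂m, f x ≠ 0 → (x ∈ B ↔ p)) : indOp m B hB f = if p then f else 0 := by
  ext1
  have h0 : ((if p then f else 0 : Lp ℂ 2 m) : α → ℂ) =ᵐ[m] fun x => if p then f x else 0 := by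
    split_ifs
    · rfl
    · exact Lp.coeFn_zero _ _ _
  filter_upwards [h, coeFn_indOp hB f, h0] with x hx h1 h2
  rw [h1, h2]
  by_cases hf : f x = 0
  · simp [indicator, hf]
  · simp [indicator, hx hf]

theorem nearest_add_mul (x : ℝ) (n : ℤ) : nearest (x + c * n) = nearest x + n := by
  have hc := c_pos
  unfold nearest
  rw [← Int.floor_add_intCast]
  congr 1
  field_simp
  ring

theorem abs_le_of_mem_box {s : ℝ} {v : ℝ × ℝ} (hv : v ∈ box s) : |v.1| ≤ s ∧ |v.2| ≤ s := by
  obtain ⟨⟨h1, h2⟩, h3, h4⟩ := hv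
  exact ⟨abs_le.2 ⟨h1, h2.le⟩, abs_le.2 ⟨h3, h4.le⟩⟩

theorem coeFn_window (r : ℝ) (f : Syndrome) :
    ∀ᵐ z ∂cell.prod cell, window r f z ≠ 0 → |z.1| < r ∧ |z.2| < r := by
  have hB : MeasurableSet {z : ℝ × ℝ | |z.1| < r ∧ |z.2| < r} := by measurability
  filter_upwards [coeFn_indOp hB f] with z hz hne
  by_contra hcon
  exact hne (hz.trans (indicator_of_notMem (by simpa using hcon) _))

theorem synthFun_window_ne_zero (r : ℝ) (f : Syndrome) (ν : Fin 2) :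
    ∀ᵐ x : ℝ, synthFun ν (window r f) x ≠ 0 →
      nearest x % 2 = ((ν : ℕ) : ℤ) ∧ |x - c * nearest x| < r := by
  filter_upwards [ae_of_cell (Measure.ae_ae_of_ae_prod (coeFn_window r f))] with x hx hne
  unfold synthFun at hne
  split_ifs at hne with h
  · refine ⟨h, ?_⟩
    by_contra hcon
    refine hne (mul_eq_zero_of_right _ (integral_eq_zero_of_ae ?_))
    filter_upwards [hx] with w hw
    have : window r f (x - c * nearest x, w) = 0 := by
      by_contra h'
      exact hcon (hw h').1
    simp [this]
  · exact absurd rfl hne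

theorem nearest_eq_of_abs_lt {x : ℝ} {n : ℤ} (h : |x - c * n| < c / 2) : nearest x = n := by
  obtain ⟨h1, h2⟩ := abs_lt.1 h
  rw [← nearest_add (z := x - c * n) ⟨h1.le, h2⟩ n, sub_add_cancel]

/-- The phase in `v.2` does not affect the support, and the shift by `v.1` leaves each point nearest
to the same multiple of `c`. -/
theorem indOp_bin_displacement_ket {r s : ℝ} (hrs : r + s < c / 2) {v : ℝ × ℝ} (hv : v ∈ box s)
    (μ ν : Fin 2) (f : Syndrome) :
    indOp volume (bin μ) (measurableSet_bin μ) (displacement v.1 v.2 (ket ν (window r f))) =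
      if μ = ν then displacement v.1 v.2 (ket ν (window r f)) else 0 := by
  refine indOp_eq_ite _ _ _ ?_
  have hq := (measurePreserving_sub_right (volume : Measure ℝ) v.1).quasiMeasurePreserving
  filter_upwards [coeFn_displacement v.1 v.2 (ket ν (window r f)),
    hq.ae (coeFn_ket ν (window r f)), hq.ae (synthFun_window_ne_zero r f ν)] with x h1 h2 h3 hne
  rw [h1, h2] at hne
  obtain ⟨h4, h5⟩ := h3 (right_ne_zero_of_mul hne)
  refine mem_bin_iff ?_
  rwa [nearest_eq_of_abs_lt (n := nearest (x - v.1))]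
  have := (abs_le_of_mem_box hv).1
  rw [abs_lt] at h5 ⊢
  rw [abs_le] at this
  constructor <;> linarith [h5.1, h5.2, this.1, this.2]

end Spectral

/-! ### Momentum readout through the distribution of `p` modulo `2c`. -/

section Momentum

instance : Fact (0 < 2 * c) := ⟨by linarith [c_pos]⟩

theorem fourier_coe_two_mul_c (n : ℤ) (x : ℝ) :
    fourier n (x : AddCircle (2 * c)) = Complex.exp (Complex.I * ((c * n * x : ℝ) : ℂ)) := by
  rw [fourier_coe_apply]
  congr 1
  have hpi : (Real.pi : ℂ) = c * c := by rw [← c_sq]; push_cast; ring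
  have hc0 : (c : ℂ) ≠ 0 := by exact_mod_cast c_pos.ne'
  rw [hpi]
  push_cast
  field_simp

/-- Multiplication of the syndrome wave function by `exp (i c n (z₂ + θ))`. -/
noncomputable def syndromePhase (n : ℤ) (θ : ℝ) : Syndrome →L[ℂ] Syndrome :=
  mulOp (cell.prod cell) (fun z => fourier n ((z.2 + θ : ℝ) : AddCircle (2 * c)))
    (by simp only [fourier_coe_two_mul_c]; fun_prop)
    (fun z => by rw [fourier_apply, Circle.norm_coe])

theorem coeFn_syndromePhase (n : ℤ) (θ : ℝ) (f : Syndrome) :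
    syndromePhase n θ f =ᵐ[cell.prod cell] fun z =>
      fourier n ((z.2 + θ : ℝ) : AddCircle (2 * c)) * f z :=
  coeFn_mulOp _ _ _ f

theorem syndromePhase_add (n : ℤ) (θ θ' : ℝ) (f : Syndrome) :
    syndromePhase n (θ + θ') f =
      Complex.exp (Complex.I * ((c * n * θ' : ℝ) : ℂ)) • syndromePhase n θ f := by
  ext1
  filter_upwards [coeFn_syndromePhase n (θ + θ') f, coeFn_syndromePhase n θ f,
    Lp.coeFn_smul (Complex.exp (Complex.I * ((c * n * θ' : ℝ) : ℂ))) (syndromePhase n θ f)]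
    with z h1 h2 h3
  rw [h1, h3, Pi.smul_apply, h2, smul_eq_mul, ← mul_assoc, fourier_coe_two_mul_c,
    fourier_coe_two_mul_c, ← Complex.exp_add]
  congr 2
  push_cast
  ring

/-- As `π = c * c`, the sign of the `X` eigenstate is the character at an offset `c ν` of `z₂`. -/
theorem neg_one_pow_zpow (ν : ℕ) (n : ℤ) :
    ((-1 : ℂ) ^ ν) ^ n = Complex.exp (Complex.I * ((c * n * (c * ν) : ℝ) : ℂ)) := by
  rw [← Complex.exp_pi_mul_I, ← Complex.exp_nat_mul, ← Complex.exp_int_mul]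
  congr 1
  have hpi : (Real.pi : ℂ) = c * c := by rw [← c_sq]; push_cast; ring
  rw [hpi]
  push_cast
  ring

/-- The wave function of `|ν⟩ ⊗ f` for the eigenvectors of the Pauli operator `X`. -/
noncomputable def signedSynthFun (ν : Fin 2) (f : ℝ × ℝ → ℂ) (x : ℝ) : ℂ :=
  invSqrtTwo * (((-1 : ℂ) ^ (ν : ℕ)) ^ nearest x * (((√c)⁻¹ : ℝ) *
    ∫ z₂, Complex.exp (Complex.I *
        (((x - c * nearest x) * z₂ / 2 + c * z₂ * nearest x : ℝ) : ℂ)) *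
      f (x - c * nearest x, z₂) ∂cell))

theorem signedSynthFun_congr (ν : Fin 2) {f g : ℝ × ℝ → ℂ} (h : f =ᵐ[cell.prod cell] g) :
    signedSynthFun ν f =ᵐ[volume] signedSynthFun ν g := by
  filter_upwards [ae_of_cell (Measure.ae_ae_of_ae_prod h)] with x hx
  unfold signedSynthFun
  congr 3
  exact integral_congr_ae (by filter_upwards [hx] with z hz; rw [hz])

/-- At each point only the ket with the parity of `nearest x` contributes, with coefficient `((-1) ^
ν) ^ nearest x`. -/
theorem coeFn_basisKet_X (ν : Fin 2) (f : Syndrome) :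
    basisKet .X ν f =ᵐ[volume] signedSynthFun ν f := by
  have h0 : basisKet .X ν f = invSqrtTwo • (ket 0 f + (-1 : ℂ) ^ (ν : ℕ) • ket 1 f) := rfl
  rw [h0]
  filter_upwards [coeFn_ket 0 f, coeFn_ket 1 f,
    Lp.coeFn_smul invSqrtTwo (ket 0 f + (-1 : ℂ) ^ (ν : ℕ) • ket 1 f),
    Lp.coeFn_add (ket 0 f) ((-1 : ℂ) ^ (ν : ℕ) • ket 1 f),
    Lp.coeFn_smul ((-1 : ℂ) ^ (ν : ℕ)) (ket 1 f)] with x h1 h2 h3 h4 h5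
  rw [h3, Pi.smul_apply, h4, Pi.add_apply, h5, Pi.smul_apply, h1, h2, smul_eq_mul, smul_eq_mul]
  unfold signedSynthFun synthFun
  congr 1
  have hsq : ((-1 : ℂ) ^ (ν : ℕ)) * (-1 : ℂ) ^ (ν : ℕ) = 1 := by
    rw [← mul_pow]; simp
  rcases Int.emod_two_eq_zero_or_one (nearest x) with h | h
  · have hz : ((-1 : ℂ) ^ (ν : ℕ)) ^ nearest x = 1 := by
      rw [← Int.mul_ediv_add_emod (nearest x) 2, h, add_zero, zpow_mul, zpow_two, hsq, one_zpow]
    rw [hz, h]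
    simp
  · have hz : ((-1 : ℂ) ^ (ν : ℕ)) ^ nearest x = (-1 : ℂ) ^ (ν : ℕ) := by
      rw [← Int.mul_ediv_add_emod (nearest x) 2, h, zpow_add₀ (by simp), zpow_mul, zpow_two, hsq,
        one_zpow, one_mul, zpow_one]
    rw [hz, h]
    simp

/-- Translation by `c n` keeps `x - c * nearest x` and raises `nearest x` by `n`, so the integrand
only gains the phase `exp (i c n (z₂ + c ν))`. -/
theorem signedSynthFun_add_mul (ν : Fin 2) (n : ℤ) (f : ℝ × ℝ → ℂ) (x : ℝ) :
    signedSynthFun ν f (x + c * n) = signedSynthFun ν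
      (fun z => fourier n ((z.2 + c * (ν : ℕ) : ℝ) : AddCircle (2 * c)) * f z) x := by
  unfold signedSynthFun
  rw [nearest_add_mul, zpow_add₀ (by simp)]
  have hx : x + c * n - c * ((nearest x + n : ℤ) : ℝ) = x - c * nearest x := by push_cast; ring
  rw [hx, mul_assoc _ (_ ^ n), mul_left_comm (_ ^ n), ← integral_const_mul (_ ^ n)]
  congr 4 with w
  beta_reduce
  have hE : ∀ u v a : ℂ, Complex.exp u * (Complex.exp v * a) = Complex.exp (u + v) * a :=
    fun u v a => by rw [Complex.exp_add, mul_assoc]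
  rw [neg_one_pow_zpow, fourier_coe_two_mul_c, hE, hE]
  congr 2
  push_cast
  ring

theorem displacement_basisKet_X (ν : Fin 2) (n : ℤ) (f : Syndrome) :
    displacement (-(c * n)) 0 (basisKet .X ν f) =
      basisKet .X ν (syndromePhase n (c * (ν : ℕ)) f) := by
  ext1
  filter_upwards [coeFn_displacement (-(c * n)) 0 (basisKet .X ν f),
    (measurePreserving_sub_right volume (-(c * n))).quasiMeasurePreserving.ae
      (coeFn_basisKet_X ν f), coeFn_basisKet_X ν (syndromePhase n (c * (ν : ℕ)) f),
      signedSynthFun_congr ν (coeFn_syndromePhase n (c * (ν : ℕ)) f)] with x h1 h2 h3 h4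
  rw [h1, h2, h3, h4, ← signedSynthFun_add_mul, sub_neg_eq_add]
  simp

/-- The Weyl commutation relation. With `a = -(c * n)` its phase shifts the offset of `z₂` by `v₂`.
-/
theorem displacement_comm (a v₁ v₂ : ℝ) (f : Mode) :
    displacement a 0 (displacement v₁ v₂ f) =
      Complex.exp (Complex.I * ((-(v₂ * a) : ℝ) : ℂ)) •
        displacement v₁ v₂ (displacement a 0 f) := by
  ext1
  have hq : ∀ v : ℝ, Measure.QuasiMeasurePreserving (fun x : ℝ => x - v) :=
    fun v => (measurePreserving_sub_right (volume : Measure ℝ) v).quasiMeasurePreserving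
  filter_upwards [coeFn_displacement a 0 (displacement v₁ v₂ f),
    (hq a).ae (coeFn_displacement v₁ v₂ f),
    Lp.coeFn_smul (Complex.exp (Complex.I * ((-(v₂ * a) : ℝ) : ℂ)))
      (displacement v₁ v₂ (displacement a 0 f)),
    coeFn_displacement v₁ v₂ (displacement a 0 f), (hq v₁).ae (coeFn_displacement a 0 f)]
    with x h1 h2 h3 h4 h5
  rw [h1, h2, h3, Pi.smul_apply, h4, h5, smul_eq_mul, ← mul_assoc, ← mul_assoc, ← mul_assoc,
    ← Complex.exp_add, ← Complex.exp_add, ← Complex.exp_add, sub_right_comm]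
  congr 2
  push_cast
  ring

theorem displacement_displacement_basisKet_X (ν : Fin 2) (n : ℤ) (v₁ v₂ : ℝ) (f : Syndrome) :
    displacement (-(c * n)) 0 (displacement v₁ v₂ (basisKet .X ν f)) =
      displacement v₁ v₂ (basisKet .X ν (syndromePhase n (c * (ν : ℕ) + v₂) f)) := by
  rw [displacement_comm, displacement_basisKet_X, syndromePhase_add, map_smul, map_smul]
  congr 4
  ring

theorem inner_displacement (v₁ v₂ : ℝ) (f g : Mode) :
    ⟪displacement v₁ v₂ f, displacement v₁ v₂ g⟫_ℂ = ⟪f, g⟫_ℂ :=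
  LinearIsometry.inner_map_map
    ⟨(displacement v₁ v₂ : Mode →ₗ[ℂ] Mode), norm_displacement v₁ v₂⟩ f g

/-- Both sides are the expectation of `V(-c n, 0) = exp (i c n p)` in the displaced state, evaluated
in momentum space with `p = 2π ξ` and on the syndrome. -/
theorem fourier_moments_eq (ν : Fin 2) (n : ℤ) (v₁ v₂ : ℝ) (f : Syndrome) :
    ∫ ξ : ℝ, fourier n ((2 * Real.pi * ξ : ℝ) : AddCircle (2 * c)) *
        ((‖Lp.fourierTransformₗᵢ ℝ ℂ (displacement v₁ v₂ (basisKet .X ν f)) ξ‖ ^ 2 : ℝ) : ℂ) =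
      ∫ z, fourier n ((z.2 + (c * (ν : ℕ) + v₂) : ℝ) : AddCircle (2 * c)) *
        ((‖f z‖ ^ 2 : ℝ) : ℂ) ∂cell.prod cell := by
  set W := displacement v₁ v₂ (basisKet .X ν f) with hW
  have h1 : ⟪W, displacement (-(c * n)) 0 W⟫_ℂ =
      ∫ z, fourier n ((z.2 + (c * (ν : ℕ) + v₂) : ℝ) : AddCircle (2 * c)) *
        ((‖f z‖ ^ 2 : ℝ) : ℂ) ∂cell.prod cell := by
    rw [hW, displacement_displacement_basisKet_X, inner_displacement, inner_basisKet]
    exact inner_mulOp_self _ _ _ f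
  rw [← h1, ← (Lp.fourierTransformₗᵢ ℝ ℂ).inner_map_map, fourierTransform_displacement_zero]
  refine Eq.trans ?_ (inner_mulOp_self _ _ _ _).symm
  refine integral_congr_ae (.of_forall fun ξ => ?_)
  simp only [fourier_coe_two_mul_c]
  congr 4
  ring

/-- Reduction modulo `2c` changes the nearest multiple of `c` by an even number of steps, so its
parity survives. -/
theorem nearest_of_coe_mem_image {t p : ℝ} (ht : t < c / 2) (ν : Fin 2)
    (h : (p : AddCircle (2 * c)) ∈
      (fun x : ℝ => (x : AddCircle (2 * c))) '' Icc (c * (ν : ℕ) - t) (c * (ν : ℕ) + t)) :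
    nearest p % 2 = ((ν : ℕ) : ℤ) := by
  obtain ⟨y, hy, hyp⟩ := h
  obtain ⟨k, hk⟩ := (AddCircle.coe_eq_zero_iff (2 * c) (x := p - y)).1 (by
    rw [AddCircle.coe_sub, ← hyp, sub_self])
  rw [zsmul_eq_mul] at hk
  have hn : nearest p = (ν : ℕ) + 2 * k := by
    refine nearest_eq_of_abs_lt (abs_lt.2 ?_)
    push_cast
    constructor <;> linarith [hy.1, hy.2]
  omega

theorem homodyne_displacement_basisKet (b : Basis) {r s : ℝ} (hrs : r + s < c / 2) {v : ℝ × ℝ}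
    (hv : v ∈ box s) (μ ν : Fin 2) (f : Syndrome) :
    homodyne b (bin μ) (measurableSet_bin μ)
        (displacement v.1 v.2 (basisKet b ν (window r f))) =
      if μ = ν then displacement v.1 v.2 (basisKet b ν (window r f)) else 0 := by
  cases b
  · exact indOp_bin_displacement_ket hrs hv μ ν f
  · set W := displacement v.1 v.2 (basisKet .X ν (window r f)) with hW
    have hB : MeasurableSet {ξ : ℝ | 2 * Real.pi * ξ ∈ bin μ} :=
      (measurableSet_bin μ).preimage (f := fun ξ : ℝ => 2 * Real.pi * ξ) (by fun_prop)
    have key : indOp volume {ξ : ℝ | 2 * Real.pi * ξ ∈ bin μ} hB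
        (Lp.fourierTransformₗᵢ ℝ ℂ W) = if μ = ν then Lp.fourierTransformₗᵢ ℝ ℂ W else 0 := by
      refine indOp_eq_ite _ _ _ ?_
      -- The closed arc of radius `r + s` about `c ν`, which carries the distribution; compactness
      -- makes it measurable.
      have hK : IsCompact ((fun x : ℝ => (x : AddCircle (2 * c))) ''
          Icc (c * (ν : ℕ) - (r + s)) (c * (ν : ℕ) + (r + s))) :=
        isCompact_Icc.image (AddCircle.continuous_mk' _)
      have hsupp := ae_eq_zero_of_fourier_moments_eq
        (u := fun ξ : ℝ => ((2 * Real.pi * ξ : ℝ) : AddCircle (2 * c)))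
        (w := fun z : ℝ × ℝ => ((z.2 + (c * (ν : ℕ) + v.2) : ℝ) : AddCircle (2 * c)))
        ((AddCircle.continuous_mk' _).measurable.comp (by fun_prop))
        ((AddCircle.continuous_mk' _).measurable.comp (by fun_prop))
        (Lp.fourierTransformₗᵢ ℝ ℂ W) (window r f)
        (fun n => fourier_moments_eq ν n v.1 v.2 (window r f)) hK.measurableSet.compl ?_
      · filter_upwards [hsupp] with ξ hξ hne
        refine mem_bin_iff (nearest_of_coe_mem_image hrs ν ?_)
        by_contra hcon
        exact hne (hξ hcon)
      · filter_upwards [coeFn_window r f] with z hz hmem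
        by_contra hne
        refine hmem ⟨_, ?_, rfl⟩
        have h1 := abs_lt.1 (hz hne).2
        have h2 := abs_le.1 (abs_le_of_mem_box hv).2
        constructor <;> linarith [h1.1, h1.2, h2.1, h2.2]
    change (Lp.fourierTransformₗᵢ ℝ ℂ).symm (indOp volume {ξ : ℝ | 2 * Real.pi * ξ ∈ bin μ} hB
        (Lp.fourierTransformₗᵢ ℝ ℂ W)) = _
    rw [key]
    split_ifs
    · exact LinearIsometryEquiv.symm_apply_apply _ _
    · exact map_zero _

end Momentum

/-! ### From single displacements to noise channels. -/

section Noise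

/-- The binned homodyne measurement operator `M_μ`. -/
noncomputable def readout (b : Basis) (μ : Fin 2) : Mode →L[ℂ] Mode :=
  homodyne b (bin μ) (measurableSet_bin μ)

theorem readout_displacement_filterOp (b : Basis) {r s : ℝ} (hrs : r + s < c / 2) {v : ℝ × ℝ}
    (hv : v ∈ box s) (μ : Fin 2) (φ : Mode) :
    readout b μ (displacement v.1 v.2 (filterOp r φ)) =
      displacement v.1 v.2 (filterPart b r μ φ) := by
  simp only [filterOp_eq_sum b r, Fin.sum_univ_two, add_apply, map_add, filterPart,
    ContinuousLinearMap.comp_apply, readout, homodyne_displacement_basisKet b hrs hv]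
  fin_cases μ <;> simp

/-- Tested against `χ`, with the readout moved onto `χ` by its adjoint, the identity equates two
matrix coefficients of `K`. These are linear and continuous in the weak operator topology, so
displacements suffice. -/
theorem readout_filterOp_of_mem_closure (b : Basis) {r s : ℝ} (hrs : r + s < c / 2)
    {K : Mode →L[ℂ] Mode} (hK : ContinuousLinearMapWOT.ofCLM K ∈
      (Submodule.span ℂ {A : Mode →WOT[ℂ] Mode | ∃ z ∈ box s,
        A = ContinuousLinearMapWOT.ofCLM (displacement z.1 z.2)}).topologicalClosure)
    (μ : Fin 2) (φ : Mode) :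
    readout b μ (K (filterOp r φ)) = K (filterPart b r μ φ) := by
  refine ext_inner_left ℂ fun χ => ?_
  rw [← ContinuousLinearMap.adjoint_inner_left]
  have hc : ∀ χ φ : Mode, Continuous fun A : Mode →WOT[ℂ] Mode => ⟪χ, A φ⟫_ℂ := fun χ φ =>
    ContinuousLinearMapWOT.continuous_dual_apply φ (innerSL ℂ χ)
  rw [← SetLike.mem_coe, Submodule.topologicalClosure_coe] at hK
  refine closure_minimal (t := {A : Mode →WOT[ℂ] Mode |
    ⟪ContinuousLinearMap.adjoint (readout b μ) χ, A (filterOp r φ)⟫_ℂ =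
      ⟪χ, A (filterPart b r μ φ)⟫_ℂ}) (fun A hA => ?_) (isClosed_eq (hc _ _) (hc _ _)) hK
  refine Submodule.span_induction ?_ ?_ ?_ ?_ hA
  · rintro _ ⟨z, hz, rfl⟩
    simp only [mem_ofPred_eq, ContinuousLinearMapWOT.ofCLM_apply,
      ContinuousLinearMap.adjoint_inner_left]
    rw [readout_displacement_filterOp b hrs hz]
  · simp
  · intro A B _ _ hA hB
    simp only [mem_ofPred_eq, ContinuousLinearMapWOT.add_apply, inner_add_right] at hA hB ⊢
    rw [hA, hB]
  · intro a A _ hA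
    simp only [mem_ofPred_eq, ContinuousLinearMapWOT.smul_apply, inner_smul_right] at hA ⊢
    rw [hA]

/-- The operator `P_μ ρ Π_r†`, where `P_μ` is the part of the filter with logical state `|μ⟩`. -/
noncomputable def halfFiltered (b : Basis) (r : ℝ) (μ : Fin 2) (ρ : traceClass Mode) :
    traceClass Mode :=
  ⟨filterPart b r μ ∘L ρ.1 ∘L ContinuousLinearMap.adjoint (filterOp r),
    conj_mem_traceClass _ _ ρ.2⟩

/-- Reading out after the noise is the same as projecting onto a logical state before it. -/
theorem readout_comp_noise (b : Basis) {r s : ℝ} (hrs : r + s < c / 2)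
    {N : traceClass Mode →ₗ[ℂ] traceClass Mode}
    (hN : HasDisplacementKraus s N ∨ HasDisplacementKernel s N) (ρ : traceClass Mode)
    (μ : Fin 2) :
    readout b μ ∘L (N (conjBy (filterOp r) ρ)).1 = (N (halfFiltered b r μ ρ)).1 := by
  ext1 ψ
  refine ext_inner_left ℂ fun φ => ?_
  -- Moving the readout onto `φ` leaves a matrix coefficient of the noise output, to which the Kraus
  -- or kernel formula applies.
  rw [ContinuousLinearMap.comp_apply, ← ContinuousLinearMap.adjoint_inner_left]
  rcases hN with ⟨K, hK, hsum⟩ | ⟨m, 𝓔, -, hsupp, hint⟩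
  · refine (hsum _ _ ψ).unique ?_
    convert! hsum (halfFiltered b r μ ρ) φ ψ using 2 with i
    rw [ContinuousLinearMap.adjoint_inner_left]
    congr 1
    exact readout_filterOp_of_mem_closure b hrs (hK i) μ _
  · rw [hint, hint]
    refine integral_congr_ae (.of_forall fun w => ?_)
    beta_reduce
    by_cases hw : 𝓔 w = 0
    · rw [hw, zero_mul, zero_mul]
    · rw [ContinuousLinearMap.adjoint_inner_left]
      congr 2
      exact readout_displacement_filterOp b hrs (hsupp w hw).1 μ _

end Noise

end GKP

theorem mainTheorem7 (r s : ℝ) (hr : 0 < r) (hrs : r + s < √Real.pi / 2)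
    (N : GKP.traceClass GKP.Mode →ₗ[ℂ] GKP.traceClass GKP.Mode) (hN : GKP.IsNoiseChannel s N)
    (ρ : GKP.traceClass GKP.Mode) (hρ : GKP.IsDensity ρ) (b : GKP.Basis) (μ : Fin 2) :
    GKP.sMeasurement N b (GKP.conjBy (GKP.filterOp r) ρ) μ =
      GKP.qubitMeasurement b (GKP.decoder (GKP.conjBy (GKP.filterOp r) ρ)) μ := by
  rw [GKP.qubitMeasurement_decoder]
  change GKP.trace (GKP.readout b μ ∘L (N (GKP.conjBy (GKP.filterOp r) ρ)).1) = _
  rw [GKP.readout_comp_noise b hrs hN.2, hN.1.trace_preserving]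
  congr 1
  ext1 φ
  -- With the noise gone, the operators agree because the eigenprojection composed with `Π_r` is
  -- `filterPart b r μ`.
  exact congrArg (GKP.basisKet b μ)
    (DFunLike.congr_fun (GKP.adjoint_basisKet_filterOp b r μ) _).symm
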